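/- Let $X$ be a real linear Polish space, i.e. a real topological vector space whose topology is separable and completely metrizable. A set $A\subset X$ is called Haar meager if there are a Borel set $B\subset X$ with $A\subset B$, a nonempty compact metric space $K$ and a continuous function $g:K\to X$ such that $g^{-1}(B+x)$ is meager in $K$ for every $x\in X$; a set $A\subset X$ is called $D$-measurable if $A=B\cup M$ for some Borel set $B\subset X$ and some Haar meager set $M\subset X$. Let $D\subset X$ be a nonempty convex open set and let $f:D\to\mathbb{R}$ be Jensen (midpoint) convex, i.e. $f\left(\frac{x+y}{2}\right)\le\frac{f(x)+f(y)}{2}$ for all $x,y\in D$. If $f$ is bounded above on some $D$-measurable set $T\subset D$ that is not Haar meager, then $f$ is continuous on $D$. -/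

import Mathlib

open Set Topology

/-- A subset `A` of an abelian topological group is *Haar meager* if there are a Borel set `B ⊇ A`,
a nonempty compact metric space `K` and a continuous map `g : K → X` such that `g ⁻¹ (B + x)` is
meager in `K` for every `x`.  (Without nonemptiness of `K` every set would qualify.  Every compact
metric space has at most continuum many points, so `K : Type` is no restriction.) -/
def IsHaarMeager {X : Type*} [AddCommGroup X] [TopologicalSpace X] (A : Set X) : Prop :=
  ∃ B : Set X, @MeasurableSet X (borel X) B ∧ A ⊆ B ∧
    ∃ (K : Type) (_ : MetricSpace K) (_ : CompactSpace K) (_ : Nonempty K) (g : K → X),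
      Continuous g ∧ ∀ x : X, IsMeagre (g ⁻¹' ((fun b => b + x) '' B))

/-- A set is *D-measurable* if it is the union of a Borel set and a Haar meager set. -/
def IsDMeasurable {X : Type*} [AddCommGroup X] [TopologicalSpace X] (A : Set X) : Prop :=
  ∃ B M : Set X, @MeasurableSet X (borel X) B ∧ IsHaarMeager M ∧ A = B ∪ M

/-- `f` is *Jensen (midpoint) convex* on `D`: `f ((x + y) / 2) ≤ (f x + f y) / 2` for all
`x, y ∈ D` (used for convex `D` only). -/
def JensenConvexOn {X : Type*} [AddCommGroup X] [Module ℝ X] (D : Set X) (f : X → ℝ) : Prop :=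
  ∀ x ∈ D, ∀ y ∈ D, f ((1 / 2 : ℝ) • (x + y)) ≤ (f x + f y) / 2

open Filter

/-! Haar meager sets are closed under unions, so the Borel part `B` of `T` is not Haar meager. By
Bernstein–Doetsch it suffices to bound `f` above near each `p ∈ D`. If this fails, pick small `w n`
with `f (p + 2⁻ᵐ • w n) > n`, each `m` serving infinitely many `n`, whose subsums define a
continuous `g` on the Cantor space. Some translate of `B` has nonmeager preimage under `g`, and
genericity gives `y` such that, for each `m`, `y + w n ∈ B` for infinitely many of the `n` assigned
to `m`. For large `m`, the `a` with `(1 - 2⁻ᵐ) • a + 2⁻ᵐ • y = p` lies in `D`. Then `p + 2⁻ᵐ • w n`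
is a dyadic combination of `a` and `y + w n`, so `f` is bounded there independently of `n`, a
contradiction. -/

/-- The forward half of the Kuratowski–Ulam theorem: almost every section of a residual subset of a
product is residual. -/
theorem eventually_residual_section {α β : Type*} [TopologicalSpace α] [TopologicalSpace β]
    [SecondCountableTopology α] {s : Set (α × β)} (hs : s ∈ residual (α × β)) :
    ∀ᶠ b in residual β, {a | (a, b) ∈ s} ∈ residual α := by
  obtain ⟨S, hSo, hSd, hSc, hS⟩ := mem_residual_iff.1 hs
  have key : ∀ t ∈ S, ∀ᶠ b in residual β, {a | (a, b) ∈ t} ∈ residual α := by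
    intro t ht
    have hb : ∀ V ∈ TopologicalSpace.countableBasis α, ∀ᶠ b in residual β, ∃ a ∈ V, (a, b) ∈ t := by
      intro V hV
      have hVo := TopologicalSpace.isOpen_of_mem_countableBasis hV
      have hVne := TopologicalSpace.nonempty_of_mem_countableBasis hV
      have heq : {b | ∃ a ∈ V, (a, b) ∈ t} = Prod.snd '' (t ∩ V ×ˢ univ) := by
        ext b
        simp [and_comm]
      refine residual_of_dense_open ?_ ?_
      · rw [heq]
        exact isOpenMap_snd _ ((hSo t ht).inter (hVo.prod isOpen_univ))
      · refine dense_iff_inter_open.2 fun W hW hWne => ?_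
        obtain ⟨⟨a, b⟩, hab, hab'⟩ :=
          (hSd t ht).inter_open_nonempty (V ×ˢ W) (hVo.prod hW) (hVne.prod hWne)
        exact ⟨b, hab.2, a, hab.1, hab'⟩
    filter_upwards [(eventually_countable_ball (TopologicalSpace.countable_countableBasis α)).2 hb]
      with b hb
    refine residual_of_dense_open ((hSo t ht).preimage (Continuous.prodMk_left b)) ?_
    refine (TopologicalSpace.isBasis_countableBasis α).dense_iff.2 fun V hV _ => ?_
    obtain ⟨a, ha, hat⟩ := hb V hV
    exact ⟨a, ha, hat⟩
  filter_upwards [(eventually_countable_ball hSc).2 key] with b hb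
  filter_upwards [(eventually_countable_ball hSc).2 hb] with a ha
  exact hS (mem_sInter.2 ha)

/-- The converse half of the Kuratowski–Ulam theorem, in the form used for Haar meager sets. -/
theorem BaireMeasurableSet.isMeagre_of_sections {α β : Type*} [TopologicalSpace α]
    [TopologicalSpace β] [SecondCountableTopology α] [BaireSpace α] [BaireSpace β]
    {s : Set (α × β)} (hs : BaireMeasurableSet s) (h : ∀ b, IsMeagre {a | (a, b) ∈ s}) :
    IsMeagre s := by
  obtain ⟨u, hu, hsu⟩ := hs.residualEq_isOpen
  rcases u.eq_empty_or_nonempty with rfl | ⟨⟨a₀, b₀⟩, hab⟩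
  · filter_upwards [hsu.mem_iff] with x hx
    simpa using hx
  obtain ⟨V, W, hV, hW, haV, hbW, hVW⟩ := isOpen_prod_iff.1 hu a₀ b₀ hab
  have hsec := eventually_residual_section (show {x | x ∈ s ↔ x ∈ u} ∈ residual (α × β) from
    hsu.mem_iff)
  obtain ⟨b, hbW', hb⟩ := (dense_of_mem_residual hsec).inter_open_nonempty W hW ⟨b₀, hbW⟩
  refine absurd ?_ (not_isMeagre_of_isOpen hV ⟨a₀, haV⟩)
  filter_upwards [hb, h b] with a ha ha' haV
  exact ha' (ha.2 (hVW ⟨haV, hbW'⟩))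

/-! ### Haar meager sets and their unions. -/

section HaarMeager

theorem preimage_add_image {X K : Type*} [AddCommGroup X] (g : K → X) (B : Set X) (x : X) :
    g ⁻¹' ((fun b => b + x) '' B) = {k | g k - x ∈ B} := by
  ext k
  simp [image_add_right, sub_eq_add_neg]

variable {X : Type*} [AddCommGroup X] [TopologicalSpace X]

/-- To show that a Borel set is Haar meager, any metrizable topology on the witness suffices. -/
theorem isHaarMeager_of_metrizable {B : Set X} (hB : @MeasurableSet X (borel X) B)
    {K : Type} [t : TopologicalSpace K] [TopologicalSpace.MetrizableSpace K] [CompactSpace K]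
    [Nonempty K] {g : K → X} (hg : Continuous g) (h : ∀ x, IsMeagre {k | g k - x ∈ B}) :
    IsHaarMeager B := by
  let := TopologicalSpace.metrizableSpaceMetric K
  exact ⟨B, hB, Subset.rfl, K, _, ‹_›, ‹_›, g, hg, fun x => by
    rw [preimage_add_image]; exact h x⟩

theorem IsHaarMeager.mono {A B : Set X} (hB : IsHaarMeager B) (h : A ⊆ B) : IsHaarMeager A := by
  obtain ⟨C, hC, hBC, hK⟩ := hB
  exact ⟨C, hC, h.trans hBC, hK⟩

variable [IsTopologicalAddGroup X]

/-- The sum map `g₁ + g₂` on `K₁ × K₂` is a common witness: fixing one coordinate leaves a translate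
of the other map, so Kuratowski–Ulam applies. -/
theorem IsHaarMeager.union {A₁ A₂ : Set X} (h₁ : IsHaarMeager A₁) (h₂ : IsHaarMeager A₂) :
    IsHaarMeager (A₁ ∪ A₂) := by
  obtain ⟨B₁, hB₁, hA₁, K₁, _, _, _, g₁, hg₁, hm₁⟩ := h₁
  obtain ⟨B₂, hB₂, hA₂, K₂, _, _, _, g₂, hg₂, hm₂⟩ := h₂
  simp only [preimage_add_image] at hm₁ hm₂
  have hmeas : ∀ (K : Type) [TopologicalSpace K] (g : K → X) (B : Set X) (x : X), Continuous g →
      @MeasurableSet X (borel X) B → BaireMeasurableSet {k | g k - x ∈ B} := by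
    intro K _ g B x hg hB
    borelize X
    borelize K
    exact MeasurableSet.baireMeasurableSet ((hg.sub continuous_const).measurable hB)
  have hm : ∀ x, IsMeagre {k : K₁ × K₂ | g₁ k.1 + g₂ k.2 - x ∈ B₁ ∪ B₂} := by
    intro x
    have hc : Continuous fun k : K₁ × K₂ => g₁ k.1 + g₂ k.2 := by fun_prop
    have hc' : Continuous fun k : K₂ × K₁ => g₁ k.2 + g₂ k.1 := by fun_prop
    refine IsMeagre.union (s := {k : K₁ × K₂ | g₁ k.1 + g₂ k.2 - x ∈ B₁})
      (t := {k : K₁ × K₂ | g₁ k.1 + g₂ k.2 - x ∈ B₂}) ?_ ?_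
    · refine (hmeas _ _ _ x hc hB₁).isMeagre_of_sections fun b => ?_
      refine (hm₁ (x - g₂ b)).mono fun k hk => ?_
      rwa [mem_ofPred_eq, sub_sub_eq_add_sub]
    · have := (hmeas _ _ _ x hc' hB₂).isMeagre_of_sections fun b => by
        refine (hm₂ (x - g₁ b)).mono fun k hk => ?_
        rwa [mem_ofPred_eq, sub_sub_eq_add_sub, add_comm]
      exact this.preimage_of_isOpenMap continuous_swap (Homeomorph.prodComm K₁ K₂).isOpenMap
  refine (isHaarMeager_of_metrizable ?_ (g := fun k : K₁ × K₂ => g₁ k.1 + g₂ k.2)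
    (by fun_prop) hm).mono (union_subset_union hA₁ hA₂)
  borelize X
  exact MeasurableSet.union hB₁ hB₂

end HaarMeager

/-! ### Subsum maps and category on the Cantor space. -/

section Cantor

/-- In a completely metrizable group one can pick, from sets accumulating at `0`, a sequence whose
subsums define a continuous function on the Cantor space. -/
theorem exists_continuous_subsums {X : Type*} [AddCommGroup X] [TopologicalSpace X]
    [IsTopologicalAddGroup X] [PolishSpace X] {P : ℕ → X → Prop}
    (hP : ∀ n, ∃ᶠ w in 𝓝 (0 : X), P n w) :
    ∃ w : ℕ → X, (∀ n, P n (w n)) ∧ ∃ g : (ℕ → Bool) → X, Continuous g ∧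
      ∀ k n, k n = false → g (Function.update k n true) = g k + w n := by
  classical
  let := TopologicalSpace.upgradeIsCompletelyMetrizable X
  -- The metric need not be translation invariant, so smallness of `w` is required at every earlier
  -- subsum; there are finitely many.
  have hW : ∀ (n : ℕ) (S : Finset X), ∃ w, P n w ∧ ∀ s ∈ S, dist s (s + w) < (1 / 2 : ℝ) ^ n := by
    intro n S
    have : ∀ᶠ w in 𝓝 (0 : X), ∀ s ∈ S, dist s (s + w) < (1 / 2 : ℝ) ^ n := by
      refine (Finset.eventually_all S).2 fun s _ => ?_
      have hc : Continuous fun w : X => dist s (s + w) := by fun_prop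
      refine hc.continuousAt.eventually_lt continuousAt_const ?_
      simp
    obtain ⟨w, hw⟩ := ((hP n).and_eventually this).exists
    exact ⟨w, hw⟩
  choose W hWP hWd using hW
  let S : ℕ → Finset X := fun n =>
    Nat.rec {0} (fun n S => S ∪ S.image fun s => s + W n S) n
  have hS : ∀ n, S (n + 1) = S n ∪ (S n).image fun s => s + W n (S n) := fun n => rfl
  let w : ℕ → X := fun n => W n (S n)
  let σ : ℕ → (ℕ → Bool) → X := fun n k => ∑ i ∈ Finset.range n, if k i then w i else 0
  have hσ : ∀ n k, σ n k ∈ S n := by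
    intro n k
    induction n with
    | zero => simp [σ, S]
    | succ n ih =>
      have : σ (n + 1) k = σ n k + if k n then w n else 0 := Finset.sum_range_succ _ _
      rw [this, hS, Finset.mem_union]
      by_cases hk : k n = true
      · right
        rw [if_pos hk]
        exact Finset.mem_image_of_mem (fun s => s + W n (S n)) ih
      · left
        simpa [hk] using ih
  have hd : ∀ k n, dist (σ n k) (σ (n + 1) k) ≤ 1 * (1 / 2 : ℝ) ^ n := by
    intro k n
    have : σ (n + 1) k = σ n k + if k n then w n else 0 := Finset.sum_range_succ _ _
    rw [this, one_mul]
    by_cases hk : k n = true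
    · simpa [hk] using (hWd n (S n) _ (hσ n k)).le
    · simp [hk]
  have hlim : ∀ k, ∃ x, Tendsto (fun n => σ n k) atTop (𝓝 x) := fun k =>
    cauchySeq_tendsto_of_complete
      (cauchySeq_of_le_geometric (1 / 2) 1 (by norm_num) (hd k))
  choose g hg using hlim
  have hcont : Continuous g := by
    have hu : TendstoUniformly σ g atTop := by
      rw [Metric.tendstoUniformly_iff]
      intro ε hε
      have h0 : Tendsto (fun n : ℕ => 1 * (1 / 2 : ℝ) ^ n / (1 - 1 / 2)) atTop (𝓝 0) := by
        have := (tendsto_pow_atTop_nhds_zero_of_lt_one (r := (1 / 2 : ℝ)) (by norm_num)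
          (by norm_num)).const_mul 1 |>.div_const (1 - 1 / 2)
        simpa using this
      filter_upwards [h0.eventually_lt_const hε] with n hn k
      rw [dist_comm]
      exact (dist_le_of_le_geometric_of_tendsto (1 / 2) 1 (by norm_num) (hd k) (hg k) n).trans_lt hn
    refine hu.continuous (Frequently.of_forall fun n => ?_)
    refine continuous_finsetSum _ fun i _ => ?_
    exact (continuous_of_discreteTopology (f := fun b : Bool => if b then w i else 0)).comp
      (continuous_apply i)
  refine ⟨w, fun n => hWP _ _, g, hcont, fun k n hk => ?_⟩
  refine tendsto_nhds_unique (hg _) (((hg k).add_const (w n)).congr' ?_)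
  filter_upwards [eventually_gt_atTop n] with m hm
  simp only [σ]
  rw [← Finset.add_sum_erase _ _ (Finset.mem_range.2 hm),
    ← Finset.add_sum_erase _ (fun i => if Function.update k n true i then w i else 0)
      (Finset.mem_range.2 hm)]
  have : ∀ i ∈ (Finset.range m).erase n,
      (if Function.update k n true i then w i else 0) = if k i then w i else 0 := by
    intro i hi
    rw [Function.update_of_ne (Finset.ne_of_mem_erase hi)]
  rw [Finset.sum_congr rfl this]
  simp [hk, add_comm]

/-- Flipping one coordinate of the Cantor space. -/
def flipCoord (n : ℕ) (k : ℕ → Bool) : ℕ → Bool := Function.update k n (!k n)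

theorem flipCoord_involutive (n : ℕ) : Function.Involutive (flipCoord n) := by
  intro k
  simp [flipCoord]

theorem continuous_flipCoord (n : ℕ) : Continuous (flipCoord n) :=
  continuous_id.update n ((continuous_of_discreteTopology (f := Bool.not)).comp (continuous_apply n))

theorem isOpenMap_flipCoord (n : ℕ) : IsOpenMap (flipCoord n) := fun U hU => by
  rw [image_eq_preimage_of_inverse (flipCoord_involutive n) (flipCoord_involutive n)]
  exact hU.preimage (continuous_flipCoord n)

/-- A generic point of the Cantor space vanishes infinitely often along an infinite index set. -/
theorem eventually_residual_frequently_false {p : ℕ → Prop} (hp : ∃ᶠ n in atTop, p n) :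
    ∀ᶠ k in residual (ℕ → Bool), ∃ᶠ n in atTop, p n ∧ k n = false := by
  simp only [frequently_atTop, eventually_countable_forall]
  intro N
  have heq : {k : ℕ → Bool | ∃ n ≥ N, p n ∧ k n = false} =
      ⋃ n ∈ {n | N ≤ n ∧ p n}, (fun k : ℕ → Bool => k n) ⁻¹' {false} := by
    ext k
    simp [and_assoc]
  refine residual_of_dense_open ?_ ?_
  · rw [heq]
    exact isOpen_biUnion fun n _ => (isOpen_discrete _).preimage (continuous_apply n)
  · intro k
    refine mem_closure_iff_nhds.2 fun U hU => ?_
    rw [nhds_pi, Filter.mem_pi] at hU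
    obtain ⟨I, hI, V, hV, hVU⟩ := hU
    obtain ⟨N', hN'⟩ := hI.bddAbove
    obtain ⟨n, hn, hpn⟩ := frequently_atTop.1 hp (max N (N' + 1))
    refine ⟨Function.update k n false, hVU fun i hi => ?_, n, le_of_max_le_left hn, hpn, by simp⟩
    have : i ≠ n := by
      have := hN' hi
      have := le_of_max_le_right hn
      omega
    rw [Function.update_of_ne this]
    exact mem_of_mem_nhds (hV i)

/-- A nonmeagre Baire measurable subset of the Cantor space contains a point such that, along each
of countably many infinite index sets, infinitely often the coordinate is `false` and
may be changed to `true` without leaving the set. -/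
theorem exists_mem_frequently_update_mem {E : Set (ℕ → Bool)} (hE : BaireMeasurableSet E)
    (hne : ¬ IsMeagre E) {ι : Type*} [Countable ι] {p : ι → ℕ → Prop}
    (hp : ∀ i, ∃ᶠ n in atTop, p i n) :
    ∃ k : ℕ → Bool, ∀ i, ∃ᶠ n in atTop, p i n ∧ k n = false ∧ Function.update k n true ∈ E := by
  obtain ⟨U, hU, hEU⟩ := hE.residualEq_isOpen
  have hUne : U.Nonempty := by
    rw [nonempty_iff_ne_empty]
    rintro rfl
    refine hne ?_
    filter_upwards [hEU.mem_iff] with x hx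
    simpa using hx
  obtain ⟨k₀, hk₀⟩ := hUne
  have hUn := hU.mem_nhds hk₀
  rw [nhds_pi, Filter.mem_pi] at hUn
  obtain ⟨I, hI, V, hV, hVU⟩ := hUn
  have hV₀ : I.pi (fun i => interior (V i)) ⊆ U :=
    (Set.pi_mono fun i _ => interior_subset).trans hVU
  have hVo : IsOpen (I.pi fun i => interior (V i)) := isOpen_set_pi hI fun _ _ => isOpen_interior
  -- Flips are homeomorphisms, so for generic `k` all flips see `E` as the open set `U`; flips
  -- beyond the support of a cylinder in `U` stay in `U`.
  have hflip : ∀ᶠ k in residual (ℕ → Bool), ∀ n, flipCoord n k ∈ E ↔ flipCoord n k ∈ U :=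
    eventually_countable_forall.2 fun n =>
      (tendsto_residual_of_isOpenMap (continuous_flipCoord n) (isOpenMap_flipCoord n)).eventually
        hEU.mem_iff
  have hfalse : ∀ᶠ k in residual (ℕ → Bool), ∀ i, ∃ᶠ n in atTop, p i n ∧ k n = false :=
    eventually_countable_forall.2 fun i => eventually_residual_frequently_false (hp i)
  obtain ⟨k, hkV, hk, hk'⟩ := (dense_of_mem_residual (hflip.and hfalse)).inter_open_nonempty _ hVo
    ⟨k₀, fun i _ => mem_interior_iff_mem_nhds.2 (hV i)⟩
  obtain ⟨N, hN⟩ := hI.bddAbove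
  refine ⟨k, fun i => ((hk' i).and_eventually (eventually_gt_atTop N)).mono ?_⟩
  rintro n ⟨⟨hpn, hkn⟩, hn⟩
  have heq : flipCoord n k = Function.update k n true := by simp [flipCoord, hkn]
  refine ⟨hpn, hkn, heq ▸ (hk n).2 (hV₀ fun j hj => ?_)⟩
  have : j ≠ n := by
    have := hN hj
    omega
  rw [flipCoord, Function.update_of_ne this]
  exact hkV j hj

end Cantor

/-! ### Jensen convexity and local boundedness. -/

section Jensen

variable {X : Type*} [AddCommGroup X] [Module ℝ X] {D : Set X} {f : X → ℝ}

theorem JensenConvexOn.dyadic (hf : JensenConvexOn D f) (hD : Convex ℝ D) {a b : X} (ha : a ∈ D)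
    (hb : b ∈ D) (m : ℕ) :
    f ((1 - (1 / 2 : ℝ) ^ m) • a + (1 / 2 : ℝ) ^ m • b) ≤
      (1 - (1 / 2 : ℝ) ^ m) * f a + (1 / 2 : ℝ) ^ m * f b := by
  induction m with
  | zero => simp
  | succ m ih =>
    have h1 : (1 / 2 : ℝ) ^ m ≤ 1 := pow_le_one₀ (by norm_num) (by norm_num)
    have hc : (1 - (1 / 2 : ℝ) ^ m) • a + (1 / 2 : ℝ) ^ m • b ∈ D :=
      hD ha hb (by linarith) (by positivity) (by ring)
    have h := hf a ha _ hc
    have heq : (1 / 2 : ℝ) • (a + ((1 - (1 / 2 : ℝ) ^ m) • a + (1 / 2 : ℝ) ^ m • b)) =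
        (1 - (1 / 2 : ℝ) ^ (m + 1)) • a + (1 / 2 : ℝ) ^ (m + 1) • b := by
      rw [pow_succ]
      module
    rw [heq] at h
    rw [pow_succ] at h ⊢
    linarith

variable [TopologicalSpace X] [IsTopologicalAddGroup X] [ContinuousSMul ℝ X]

/-- The Bernstein–Doetsch theorem: a Jensen convex function bounded above near a point is
continuous there. -/
theorem JensenConvexOn.continuousAt_of_eventually_le (hf : JensenConvexOn D f) (hD : Convex ℝ D)
    (hDo : IsOpen D) {p : X} (hp : p ∈ D) {C : ℝ} (hC : ∀ᶠ v in 𝓝 (0 : X), f (p + v) ≤ C) :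
    ContinuousAt f p := by
  have hDn : ∀ᶠ v in 𝓝 (0 : X), p + v ∈ D := by
    have hc : Continuous fun v : X => p + v := by fun_prop
    exact hc.continuousAt.eventually_mem (by simpa using hDo.mem_nhds hp)
  have hup : ∀ ε > 0, ∀ᶠ v in 𝓝 (0 : X), f (p + v) < f p + ε := by
    intro ε hε
    obtain ⟨m, hm⟩ : ∃ m : ℕ, (1 / 2 : ℝ) ^ m * (C - f p) < ε := by
      have := (tendsto_pow_atTop_nhds_zero_of_lt_one (r := (1 / 2 : ℝ)) (by norm_num)
          (by norm_num)).mul_const (C - f p)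
      rw [zero_mul] at this
      exact (this.eventually_lt_const hε).exists
    have hsc : Tendsto (fun v : X => (2 : ℝ) ^ m • v) (𝓝 0) (𝓝 0) := by
      have hc : Continuous fun v : X => (2 : ℝ) ^ m • v := by fun_prop
      simpa using hc.tendsto 0
    filter_upwards [hsc.eventually hDn, hsc.eventually hC] with v hvD hvC
    have h := hf.dyadic hD hp hvD m
    have heq : (1 - (1 / 2 : ℝ) ^ m) • p + (1 / 2 : ℝ) ^ m • (p + (2 : ℝ) ^ m • v) = p + v := by
      rw [smul_add, smul_smul, ← mul_pow, sub_smul]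
      norm_num
      abel
    rw [heq] at h
    have := mul_le_mul_of_nonneg_left hvC (by positivity : (0 : ℝ) ≤ (1 / 2) ^ m)
    linarith
  have hneg : Tendsto (fun v : X => -v) (𝓝 0) (𝓝 0) := by
    simpa using (continuous_neg (G := X)).tendsto 0
  have hmain : Tendsto (fun v => f (p + v)) (𝓝 0) (𝓝 (f p)) := by
    rw [Metric.tendsto_nhds]
    intro ε hε
    -- Since `p` is the midpoint of `p + v` and `p - v`, the upper estimate at `p - v` yields the
    -- lower one at `p + v`.
    filter_upwards [hDn, hneg.eventually hDn, hup ε hε, hneg.eventually (hup ε hε)]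
      with v h1 h2 h3 h4
    have h := hf _ h1 _ h2
    have heq : (1 / 2 : ℝ) • (p + v + (p + -v)) = p := by module
    rw [heq] at h
    rw [Real.dist_eq, abs_lt]
    constructor <;> linarith
  have hsub : Tendsto (fun x : X => x - p) (𝓝 p) (𝓝 0) := by
    have hc : Continuous fun x : X => x - p := by fun_prop
    simpa using hc.tendsto p
  refine (hmain.comp hsub).congr fun x => ?_
  simp

/-- A Jensen convex function bounded above on a Borel set that is not Haar meager is locally
bounded above. -/
theorem JensenConvexOn.exists_eventually_le [PolishSpace X] (hf : JensenConvexOn D f)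
    (hD : Convex ℝ D) (hDo : IsOpen D) {B : Set X} (hBm : @MeasurableSet X (borel X) B)
    (hBD : B ⊆ D) (hB : ¬ IsHaarMeager B) {c : ℝ} (hc : ∀ x ∈ B, f x ≤ c) {p : X} (hp : p ∈ D) :
    ∃ C, ∀ᶠ v in 𝓝 (0 : X), f (p + v) ≤ C := by
  by_contra! hcon
  -- `n.unpair.1` is the exponent `m` assigned to `n`; it takes each value infinitely often.
  obtain ⟨w, hw, g, hg, hgw⟩ := exists_continuous_subsums
      (P := fun n w => (n : ℝ) < f (p + (1 / 2 : ℝ) ^ n.unpair.1 • w)) (fun n => by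
    have hsc : Tendsto (fun v : X => (2 : ℝ) ^ n.unpair.1 • v) (𝓝 0) (𝓝 0) := by
      have hc : Continuous fun v : X => (2 : ℝ) ^ n.unpair.1 • v := by fun_prop
      simpa using hc.tendsto 0
    refine hsc.frequently ((hcon n).mono fun v hv => ?_)
    rw [smul_smul, ← mul_pow]
    norm_num
    exact hv)
  obtain ⟨x, hx⟩ : ∃ x, ¬ IsMeagre {k | g k - x ∈ B} := by
    by_contra! h
    exact hB (isHaarMeager_of_metrizable hBm hg h)
  have hE : BaireMeasurableSet {k | g k - x ∈ B} := by
    borelize X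
    borelize (ℕ → Bool)
    exact MeasurableSet.baireMeasurableSet ((hg.sub continuous_const).measurable hBm)
  have hinf : ∀ m : ℕ, ∃ᶠ n : ℕ in atTop, n.unpair.1 = m := fun m =>
    frequently_atTop.2 fun N => ⟨Nat.pair m N, Nat.right_le_pair m N, by simp⟩
  obtain ⟨k, hk⟩ := exists_mem_frequently_update_mem hE hx hinf
  -- `y` itself need not lie in `B`; only the points `y + w n` are used.
  set y := g k - x with hy
  have hr : Tendsto (fun m : ℕ => (1 / 2 : ℝ) ^ m) atTop (𝓝 0) :=
    tendsto_pow_atTop_nhds_zero_of_lt_one (by norm_num) (by norm_num)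
  have ha : Tendsto (fun m : ℕ => (1 - (1 / 2 : ℝ) ^ m)⁻¹ • (p - (1 / 2 : ℝ) ^ m • y)) atTop
      (𝓝 p) := by
    have h1 : Tendsto (fun m : ℕ => (1 - (1 / 2 : ℝ) ^ m)⁻¹) atTop (𝓝 (1 - 0)⁻¹) :=
      (hr.const_sub 1).inv₀ (by norm_num)
    simpa using h1.smul ((hr.smul_const y).const_sub p)
  obtain ⟨m, hm, hm1⟩ := ((ha.eventually_mem (hDo.mem_nhds hp)).and
    (hr.eventually_lt_const one_pos)).exists
  set t := (1 / 2 : ℝ) ^ m with ht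
  set a := (1 - t)⁻¹ • (p - t • y) with ha'
  -- `m` and `a` are fixed before `n`, so the convexity bound does not depend on `n` and can be
  -- exceeded.
  obtain ⟨n, ⟨hnm, hkn, hkB⟩, hn⟩ :=
    ((hk m).and_eventually (eventually_gt_atTop ⌈(1 - t) * f a + t * c⌉₊)).exists
  have hb : y + w n ∈ B := by
    have : g (Function.update k n true) - x ∈ B := hkB
    rw [hgw k n hkn] at this
    rwa [hy, sub_add_eq_add_sub]
  have h := hf.dyadic hD hm (hBD hb) m
  rw [← ht] at h
  have heq : (1 - t) • a + t • (y + w n) = p + t • w n := by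
    rw [ha', smul_smul, mul_inv_cancel₀ (by linarith), one_smul, smul_add]
    abel
  rw [heq] at h
  have hwn := hw n
  rw [hnm, ← ht] at hwn
  have h2 := mul_le_mul_of_nonneg_left (hc _ hb) (by positivity : 0 ≤ t)
  have h3 := (Nat.le_ceil _).trans_lt (Nat.cast_lt (α := ℝ).2 hn)
  linarith

end Jensen

theorem mainTheorem2 {X : Type*} [AddCommGroup X] [Module ℝ X] [TopologicalSpace X]
    [IsTopologicalAddGroup X] [ContinuousSMul ℝ X] [PolishSpace X]
    (D : Set X) (hDne : D.Nonempty) (hDconv : Convex ℝ D) (hDopen : IsOpen D)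
    (f : X → ℝ) (hf : JensenConvexOn D f)
    (T : Set X) (hTD : T ⊆ D) (hTmeas : IsDMeasurable T) (hTbig : ¬ IsHaarMeager T)
    (hbdd : BddAbove (f '' T)) :
    ContinuousOn f D := by
  obtain ⟨B, M, hB, hM, rfl⟩ := hTmeas
  obtain ⟨c, hc⟩ := hbdd
  have hBbig : ¬ IsHaarMeager B := fun h => hTbig (h.union hM)
  intro p hp
  obtain ⟨C, hC⟩ := hf.exists_eventually_le hDconv hDopen hB (subset_union_left.trans hTD) hBbig
    (fun x hx => hc (mem_image_of_mem f (Or.inl hx))) hp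
  exact (hf.continuousAt_of_eventually_le hDconv hDopen hp hC).continuousWithinAt
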